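/- Let $\mathcal H$ be a finite-dimensional complex Hilbert space, let $\rho$ be a density operator on $\mathcal H$ (a positive semidefinite operator with $\operatorname{Tr}\rho=1$), let $\sigma$ be a positive semidefinite operator on $\mathcal H$ with $\ker\sigma\subseteq\ker\rho$ (equivalently $\operatorname{supp}\rho\subseteq\operatorname{supp}\sigma$), and let $\alpha\in\mathbb R\setminus\{1\}$. For $z>0$ put $$D_{\alpha,z}(\rho\|\sigma):=\frac{1}{\alpha-1}\log\operatorname{Tr}\left(\left(\sigma^{\frac{1-\alpha}{2z}}\rho^{\frac{\alpha}{z}}\sigma^{\frac{1-\alpha}{2z}}\right)^{z}\right),$$ where a real power $T^s$ of a positive semidefinite operator $T$ is taken on the support of $T$: if $T=\sum_i\lambda_iP_i$ is the spectral decomposition, then $T^s=\sum_{i:\lambda_i>0}\lambda_i^sP_i$. Then the function $z\mapsto D_{\alpha,z}(\rho\|\sigma)$ on $(0,\infty)$ is monotonically decreasing (non-increasing) if $\alpha>1$ and monotonically increasing (non-decreasing) if $\alpha<1$. -/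

import Mathlib

/-- `ρ` is a density operator: positive semidefinite with trace one. -/
def IsDensityOperator {H : Type*} [NormedAddCommGroup H] [InnerProductSpace ℂ H]
    (ρ : H →L[ℂ] H) : Prop :=
  ρ.IsPositive ∧ LinearMap.trace ℂ H (ρ : H →ₗ[ℂ] H) = 1

/-- `σ ≫ τ`: the kernel of `σ` is contained in the kernel of `τ`; for Hermitian operators on a
finite-dimensional space this says that the support of `τ` is contained in that of `σ`. -/
def Dominates {H : Type*} [NormedAddCommGroup H] [InnerProductSpace ℂ H]
    (σ τ : H →L[ℂ] H) : Prop :=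
  LinearMap.ker (σ : H →ₗ[ℂ] H) ≤ LinearMap.ker (τ : H →ₗ[ℂ] H)

/-- The real power `T ^ s` of a positive semidefinite operator `T` on a finite-dimensional Hilbert
space, taken on the support of `T`: every eigenvalue `x > 0` is replaced by `x ^ s`, and the
eigenvalue `0` stays `0`. So `T ^ (-1)` is the generalized inverse and `T ^ 0` is the projection
onto the support. (The spectrum is finite, so that the functional calculus applies to every
function.) -/
noncomputable def supportPow {H : Type*} [NormedAddCommGroup H] [InnerProductSpace ℂ H]
    [CompleteSpace H] (T : H →L[ℂ] H) (s : ℝ) : H →L[ℂ] H :=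
  cfc (fun x : ℝ => if x = 0 then 0 else x ^ s) T

/-- The `α`-`z` relative Rényi entropy (`α`-`z` divergence)
`(1 / (α - 1)) log Tr ((σ ^ ((1 - α) / 2z) ρ ^ (α / z) σ ^ ((1 - α) / 2z)) ^ z)`.
The trace is that of a positive semidefinite operator, hence real. -/
noncomputable def alphaZDivergence {H : Type*} [NormedAddCommGroup H] [InnerProductSpace ℂ H]
    [CompleteSpace H] (α z : ℝ) (ρ σ : H →L[ℂ] H) : ℝ :=
  1 / (α - 1) * Real.log (LinearMap.trace ℂ H
    ((supportPow (supportPow σ ((1 - α) / (2 * z)) * supportPow ρ (α / z) *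
      supportPow σ ((1 - α) / (2 * z))) z : H →L[ℂ] H) : H →ₗ[ℂ] H)).re

/-! The trace inside the logarithm is positive and non-increasing in `z`; the sign of `1 / (α - 1)`
then decides the direction. For `z ≤ w` put `p = w / z ≥ 1`, `Y = σ ^ ((1 - α) / 2w)` and `X = ρ ^
(α / w)`. The outer and inner factors belonging to `z` are `Y ^ p` and `X ^ p`, so monotonicity is
the Araki-Lieb-Thirring inequality `Tr (Y X Y) ^ (p z) ≤ Tr (Y ^ p X ^ p Y ^ p) ^ z`
(`sum_rpow_le_sum_rpow`). The Cordes inequality (`norm_conj_rpow_le`) compares the largest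
eigenvalues. Applied to `k`-th compound matrices, it compares products of the `k` largest
eigenvalues; this log-majorization yields the inequality of sums (`sum_le_sum_of_prod_le`). If the
trace vanished, then `Y X Y = 0`, and the kernel condition would force `ρ = 0`, against `Tr ρ = 1`.
-/

/-! ### Powers through diagonalization, and the Cordes inequality. -/

section MatrixPowers

open Matrix
open scoped Matrix.Norms.L2Operator MatrixOrder ComplexOrder

variable {n : Type*} [Fintype n] [DecidableEq n]

/-- The matrix `U * diag(d) * Uᴴ` with real diagonal `d`. -/
noncomputable def conjDiag (U : Matrix n n ℂ) (d : n → ℝ) : Matrix n n ℂ :=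
  U * diagonal (fun i => (d i : ℂ)) * Uᴴ

lemma conjDiag_isHermitian (U : Matrix n n ℂ) (d : n → ℝ) : (conjDiag U d).IsHermitian := by
  simp only [conjDiag, IsHermitian, conjTranspose_mul, conjTranspose_conjTranspose,
    diagonal_conjTranspose, Matrix.mul_assoc]
  congr 3
  ext i
  simp

lemma conjDiag_posSemidef (U : Matrix n n ℂ) {d : n → ℝ} (hd : 0 ≤ d) :
    (conjDiag U d).PosSemidef := by
  refine PosSemidef.mul_mul_conjTranspose_same ?_ U
  rw [posSemidef_diagonal_iff]
  intro i
  exact_mod_cast hd i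

lemma conjDiag_mul {U : Matrix n n ℂ} (hU : Uᴴ * U = 1) (d e : n → ℝ) :
    conjDiag U d * conjDiag U e = conjDiag U (d * e) := by
  calc _ = U * diagonal (fun i => (d i : ℂ)) * (Uᴴ * U) * diagonal (fun i => (e i : ℂ)) * Uᴴ := by
        simp only [conjDiag, Matrix.mul_assoc]
    _ = _ := by
        rw [hU, Matrix.mul_one, Matrix.mul_assoc U, diagonal_mul_diagonal]
        simp [conjDiag]

lemma conjDiag_one {U : Matrix n n ℂ} (hU : Uᴴ * U = 1) : conjDiag U 1 = 1 := by
  simp [conjDiag, mul_eq_one_comm.mp hU]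

lemma trace_conjDiag {U : Matrix n n ℂ} (hU : Uᴴ * U = 1) (d : n → ℝ) :
    (conjDiag U d).trace = ((∑ i, d i : ℝ) : ℂ) := by
  rw [conjDiag, trace_mul_comm, ← Matrix.mul_assoc, hU, Matrix.one_mul, trace_diagonal]
  simp

lemma norm_conjDiag {U : Matrix n n ℂ} (hU : Uᴴ * U = 1) (d : n → ℝ) :
    ‖conjDiag U d‖ = ‖d‖ := by
  have hu : U ∈ unitary (Matrix n n ℂ) := ⟨hU, mul_eq_one_comm.mp hU⟩
  rw [conjDiag, ← star_eq_conjTranspose, CStarRing.norm_mul_mem_unitary _ (Unitary.star_mem hu),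
    CStarRing.norm_mem_unitary_mul _ hu, l2_opNorm_diagonal]
  simp [Pi.norm_def]

lemma Matrix.IsHermitian.exists_conjDiag {A : Matrix n n ℂ} (hA : A.IsHermitian) :
    ∃ U : Matrix n n ℂ, Uᴴ * U = 1 ∧ A = conjDiag U hA.eigenvalues := by
  refine ⟨hA.eigenvectorUnitary, hA.eigenvectorUnitary.2.1, ?_⟩
  conv_lhs => rw [hA.spectral_theorem, Unitary.conjStarAlgAut_apply]
  rfl

lemma Matrix.PosSemidef.exists_conjDiag {A : Matrix n n ℂ} (hA : A.PosSemidef) :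
    ∃ (U : Matrix n n ℂ) (d : n → ℝ), Uᴴ * U = 1 ∧ 0 ≤ d ∧ A = conjDiag U d := by
  obtain ⟨U, hU, h⟩ := hA.1.exists_conjDiag
  exact ⟨U, _, hU, hA.eigenvalues_nonneg, h⟩

/-- The equality says that `Uᴴ * V` intertwines the two diagonals, so `d i = e j` wherever its entry
`(i, j)` is nonzero; hence it also intertwines their images under `f`. -/
lemma conjDiag_comp_eq {U V : Matrix n n ℂ} (hU : Uᴴ * U = 1) (hV : Vᴴ * V = 1) {d e : n → ℝ}
    (h : conjDiag U d = conjDiag V e) (f : ℝ → ℝ) :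
    conjDiag U (f ∘ d) = conjDiag V (f ∘ e) := by
  have hV' := mul_eq_one_comm.mp hV
  have hU' := mul_eq_one_comm.mp hU
  have key : ∀ a b : n → ℝ, diagonal (fun i => (a i : ℂ)) * (Uᴴ * V) =
      Uᴴ * V * diagonal (fun i => (b i : ℂ)) ↔ conjDiag U a = conjDiag V b := by
    intro a b
    constructor
    · intro h
      calc conjDiag U a = U * (diagonal (fun i => (a i : ℂ)) * (Uᴴ * V)) * Vᴴ := by
            simp only [conjDiag, Matrix.mul_assoc, hV', Matrix.mul_one]
        _ = (U * Uᴴ) * conjDiag V b := by rw [h]; simp only [conjDiag, Matrix.mul_assoc]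
        _ = _ := by rw [hU', Matrix.one_mul]
    · intro h
      calc _ = Uᴴ * U * diagonal (fun i => (a i : ℂ)) * (Uᴴ * V) := by rw [hU, Matrix.one_mul]
        _ = Uᴴ * conjDiag U a * V := by simp only [conjDiag, Matrix.mul_assoc]
        _ = Uᴴ * V * diagonal (fun i => (b i : ℂ)) * (Vᴴ * V) := by
            rw [h]; simp only [conjDiag, Matrix.mul_assoc]
        _ = _ := by rw [hV, Matrix.mul_one]
  rw [← key] at h ⊢
  ext i j
  have hij := congrFun₂ h i j
  simp only [diagonal_mul, mul_diagonal] at hij ⊢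
  by_cases h0 : (Uᴴ * V) i j = 0
  · simp [h0]
  · have : (d i : ℂ) = e j := mul_right_cancel₀ h0 (hij.trans (mul_comm _ _))
    rw [Function.comp_apply, Function.comp_apply, Complex.ofReal_inj.mp this, mul_comm]

lemma cfc_conjDiag {U : Matrix n n ℂ} (hU : Uᴴ * U = 1) (d : n → ℝ) (f : ℝ → ℝ) :
    cfc f (conjDiag U d) = conjDiag U (f ∘ d) := by
  have hA := conjDiag_isHermitian U d
  rw [hA.cfc_eq, IsHermitian.cfc, Unitary.conjStarAlgAut_apply]
  have h := hA.spectral_theorem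
  rw [Unitary.conjStarAlgAut_apply] at h
  exact (conjDiag_comp_eq hU hA.eigenvectorUnitary.2.1 h f).symm

lemma conjDiag_rpow {U : Matrix n n ℂ} (hU : Uᴴ * U = 1) {d : n → ℝ} (hd : 0 ≤ d) (s : ℝ) :
    (conjDiag U d) ^ s = conjDiag U (fun i => d i ^ s) := by
  rw [CFC.rpow_eq_cfc_real (conjDiag_posSemidef U hd).nonneg, cfc_conjDiag hU]
  rfl

lemma conjDiag_const {U : Matrix n n ℂ} (hU : Uᴴ * U = 1) (c : ℝ) :
    conjDiag U (fun _ => c) = algebraMap ℝ (Matrix n n ℂ) c := by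
  rw [← cfc_const c (1 : Matrix n n ℂ) (by exact isHermitian_one), ← conjDiag_one hU,
    cfc_conjDiag hU]
  rfl

lemma conjDiag_mul_algebraMap_mul {U : Matrix n n ℂ} (hU : Uᴴ * U = 1) (d e : n → ℝ) (c : ℝ) :
    conjDiag U d * algebraMap ℝ (Matrix n n ℂ) c * conjDiag U e =
      conjDiag U (fun i => d i * c * e i) := by
  rw [← conjDiag_const hU, conjDiag_mul hU, conjDiag_mul hU]
  rfl

lemma conjDiag_conj_le {U A B : Matrix n n ℂ} (d : n → ℝ) (h : A ≤ B) :
    conjDiag U d * A * conjDiag U d ≤ conjDiag U d * B * conjDiag U d := by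
  have hd : star (conjDiag U d) = conjDiag U d := conjDiag_isHermitian U d
  simpa [hd] using star_right_conjugate_le_conjugate h (conjDiag U d)

/-- The Cordes inequality for an invertible outer factor. -/
lemma norm_conj_rpow_le_of_pos {U V : Matrix n n ℂ} (hU : Uᴴ * U = 1) (hV : Vᴴ * V = 1)
    {x y : n → ℝ} (hx : 0 ≤ x) (hy : ∀ i, 0 < y i) {p : ℝ} (hp : 1 ≤ p) :
    ‖conjDiag V y * conjDiag U x * conjDiag V y‖ ≤
      ‖conjDiag V (fun i => y i ^ p) * conjDiag U (fun i => x i ^ p) *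
        conjDiag V (fun i => y i ^ p)‖ ^ p⁻¹ := by
  have hp0 : 0 < p := by linarith
  set T := conjDiag V (fun i => y i ^ p) * conjDiag U (fun i => x i ^ p) *
        conjDiag V (fun i => y i ^ p) with hT
  have hsa : ∀ a b : n → ℝ, 0 ≤ b →
      (conjDiag V a * conjDiag U b * conjDiag V a).PosSemidef := by
    intro a b hb
    have := (conjDiag_posSemidef U hb).mul_mul_conjTranspose_same (conjDiag V a)
    rwa [(conjDiag_isHermitian V a).eq] at this
  have hxp : (0 : n → ℝ) ≤ fun i => x i ^ p := fun i => Real.rpow_nonneg (hx i) p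
  have h1 : T ≤ algebraMap ℝ (Matrix n n ℂ) ‖T‖ := by
    have : IsSelfAdjoint T := (hsa _ _ hxp).1
    exact this.le_algebraMap_norm_self
  have h2 := conjDiag_conj_le (U := V) (fun i => y i ^ (-p)) h1
  have hyp : ∀ i, y i ^ (-p) * y i ^ p = 1 := fun i => by
    rw [← Real.rpow_add (hy i)]; simp
  have e1 : conjDiag V (fun i => y i ^ (-p)) * conjDiag V (fun i => y i ^ p) = 1 := by
    rw [conjDiag_mul hV, ← conjDiag_one hV]
    congr 1; ext i; exact hyp i
  have e2 : conjDiag V (fun i => y i ^ p) * conjDiag V (fun i => y i ^ (-p)) = 1 := by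
    rw [conjDiag_mul hV, ← conjDiag_one hV]
    congr 1; ext i; simpa [mul_comm] using hyp i
  have e3 : conjDiag V (fun i => y i ^ (-p)) * T * conjDiag V (fun i => y i ^ (-p)) =
      conjDiag U (fun i => x i ^ p) := by
    calc _ = (conjDiag V (fun i => y i ^ (-p)) * conjDiag V (fun i => y i ^ p)) *
          conjDiag U (fun i => x i ^ p) *
          (conjDiag V (fun i => y i ^ p) * conjDiag V (fun i => y i ^ (-p))) := by
          simp only [hT, Matrix.mul_assoc]
      _ = _ := by rw [e1, e2, Matrix.one_mul, Matrix.mul_one]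
  rw [e3, conjDiag_mul_algebraMap_mul hV] at h2
  -- By now `X ^ p ≤ ‖T‖ Y ^ (-2p)`. Löwner-Heinz with exponent `1 / p ≤ 1` gives `X ≤ ‖T‖ ^ (1 / p)
  -- Y ^ (-2)`, and conjugation by `Y` finishes.
  have h3 := CFC.rpow_le_rpow (p := p⁻¹) ⟨by positivity, inv_le_one_of_one_le₀ hp⟩ h2
  rw [conjDiag_rpow hU hxp, conjDiag_rpow hV (fun i => by
    have := (hy i).le; have := norm_nonneg T; simp only [Pi.zero_apply]; positivity)] at h3
  have h4 := conjDiag_conj_le (U := V) y h3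
  have e4 : (fun i => (x i ^ p) ^ p⁻¹) = x := by
    ext i; exact Real.rpow_rpow_inv (hx i) hp0.ne'
  rw [e4, conjDiag_mul hV, conjDiag_mul hV] at h4
  have e5 : (y * (fun i => (y i ^ (-p) * ‖T‖ * y i ^ (-p)) ^ p⁻¹) * y) =
      fun _ => ‖T‖ ^ p⁻¹ := by
    ext i
    have hyi := hy i
    have : (y i ^ (-p)) ^ p⁻¹ = (y i)⁻¹ := by
      rw [← Real.rpow_mul hyi.le, neg_mul, mul_inv_cancel₀ hp0.ne', Real.rpow_neg_one]
    simp only [Pi.mul_apply]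
    rw [Real.mul_rpow (by positivity) (by positivity), Real.mul_rpow (by positivity)
      (by positivity), this]
    field_simp
  rw [e5, conjDiag_const hV] at h4
  exact (CStarAlgebra.norm_le_iff_le_algebraMap _ (by positivity) (hsa y x hx).nonneg).mpr h4

lemma continuous_conjDiag {X : Type*} [TopologicalSpace X] (U : Matrix n n ℂ) {d : X → n → ℝ}
    (hd : Continuous d) : Continuous fun t => conjDiag U (d t) := by
  unfold conjDiag
  have : Continuous fun t => diagonal fun i => (d t i : ℂ) := by
    refine Continuous.matrix_diagonal ?_
    fun_prop
  exact (continuous_const.mul this).mul continuous_const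

/-- The Cordes inequality `‖Y X Y‖ ^ p ≤ ‖Y ^ p X ^ p Y ^ p‖` for `p ≥ 1`. -/
lemma norm_conj_rpow_le {U V : Matrix n n ℂ} (hU : Uᴴ * U = 1) (hV : Vᴴ * V = 1)
    {x y : n → ℝ} (hx : 0 ≤ x) (hy : 0 ≤ y) {p : ℝ} (hp : 1 ≤ p) :
    ‖conjDiag V y * conjDiag U x * conjDiag V y‖ ^ p ≤
      ‖conjDiag V (fun i => y i ^ p) * conjDiag U (fun i => x i ^ p) *
        conjDiag V (fun i => y i ^ p)‖ := by
  have hp0 : 0 < p := by linarith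
  rw [← Real.le_rpow_inv_iff_of_pos (norm_nonneg _) (norm_nonneg _) hp0]
  -- Zeros of `y` are handled by shifting it to `y + t` and letting `t` decrease to `0`.
  have c1 : Continuous fun t : ℝ => conjDiag V (fun i => y i + t) :=
    continuous_conjDiag V (by fun_prop)
  have c2 : Continuous fun t : ℝ => conjDiag V (fun i => (y i + t) ^ p) :=
    continuous_conjDiag V (continuous_pi fun i =>
      Continuous.rpow_const (by fun_prop) fun _ => Or.inr hp0.le)
  have l1 : Continuous fun t : ℝ => ‖conjDiag V (fun i => y i + t) * conjDiag U x *
      conjDiag V (fun i => y i + t)‖ := ((c1.mul continuous_const).mul c1).norm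
  have l2 : Continuous fun t : ℝ => ‖conjDiag V (fun i => (y i + t) ^ p) *
      conjDiag U (fun i => x i ^ p) * conjDiag V (fun i => (y i + t) ^ p)‖ ^ p⁻¹ :=
    ((c2.mul continuous_const).mul c2).norm.rpow_const fun _ => Or.inr (by positivity)
  have t1 := (l1.tendsto 0).mono_left (nhdsWithin_le_nhds (s := Set.Ioi 0))
  have t2 := (l2.tendsto 0).mono_left (nhdsWithin_le_nhds (s := Set.Ioi 0))
  simp only [add_zero] at t1 t2
  refine le_of_tendsto_of_tendsto t1 t2 ?_
  filter_upwards [self_mem_nhdsWithin] with t ht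
  exact norm_conj_rpow_le_of_pos hU hV hx
    (fun i => add_pos_of_nonneg_of_pos (hy i) ht) hp

end MatrixPowers

/-! ### Compound matrices. -/

section Compound

open Matrix

/-- The `k`-th compound matrix: the matrix of the `k`-th exterior power. -/
noncomputable def compoundMatrix {m : ℕ} (k : ℕ) (A : Matrix (Fin m) (Fin m) ℂ) :
    Matrix (Set.powersetCard (Fin m) k) (Set.powersetCard (Fin m) k) ℂ :=
  LinearMap.toMatrix ((Pi.basisFun ℂ (Fin m)).exteriorPower k)
    ((Pi.basisFun ℂ (Fin m)).exteriorPower k) (exteriorPower.map k (Matrix.toLin' A))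

variable {m : ℕ} (k : ℕ)

lemma compoundMatrix_mul (A B : Matrix (Fin m) (Fin m) ℂ) :
    compoundMatrix k (A * B) = compoundMatrix k A * compoundMatrix k B := by
  rw [compoundMatrix, toLin'_mul, exteriorPower.map_comp, LinearMap.toMatrix_comp _
    ((Pi.basisFun ℂ (Fin m)).exteriorPower k)]
  rfl

lemma compoundMatrix_one : compoundMatrix k (1 : Matrix (Fin m) (Fin m) ℂ) = 1 := by
  rw [compoundMatrix, toLin'_one, exteriorPower.map_id, LinearMap.toMatrix_id]

/-- The description by minors serves for adjoints and diagonal matrices, which functoriality alone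
does not cover. -/
lemma compoundMatrix_apply (A : Matrix (Fin m) (Fin m) ℂ) (s t : Set.powersetCard (Fin m) k) :
    compoundMatrix k A s t = (A.submatrix (Set.powersetCard.ofFinEmbEquiv.symm s)
      (Set.powersetCard.ofFinEmbEquiv.symm t)).det := by
  rw [compoundMatrix, LinearMap.toMatrix_apply, exteriorPower.basis_apply,
    exteriorPower.map_apply_ιMulti_family, exteriorPower.basis_repr_apply,
    exteriorPower.ιMulti_family, exteriorPower.ιMultiDual_apply_ιMulti, ← det_transpose]
  congr 1
  ext i j
  simp

lemma compoundMatrix_conjTranspose (A : Matrix (Fin m) (Fin m) ℂ) :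
    compoundMatrix k Aᴴ = (compoundMatrix k A)ᴴ := by
  ext s t
  rw [conjTranspose_apply, compoundMatrix_apply, compoundMatrix_apply, ← det_conjTranspose]
  rfl

lemma compoundMatrix_diagonal (d : Fin m → ℂ) :
    compoundMatrix k (diagonal d) =
      diagonal fun s : Set.powersetCard (Fin m) k => ∏ i ∈ (s : Finset (Fin m)), d i := by
  ext s t
  rw [compoundMatrix_apply]
  by_cases hst : s = t
  · subst hst
    rw [submatrix_diagonal _ _ (Set.powersetCard.ofFinEmbEquiv.symm s).injective, det_diagonal,
      diagonal_apply_eq]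
    have : (s : Finset (Fin m)) = Finset.univ.map
        (Set.powersetCard.ofFinEmbEquiv.symm s).toEmbedding := by
      ext i
      rw [Set.powersetCard.mem_coe_iff, ← Set.powersetCard.mem_range_ofFinEmbEquiv_symm_iff_mem]
      simp
    rw [this, Finset.prod_map]
    rfl
  · rw [diagonal_apply_ne _ hst]
    obtain ⟨i, his, hit⟩ := (Set.powersetCard.exists_mem_notMem_iff_ne s t).mp hst
    obtain ⟨j, rfl⟩ := (Set.powersetCard.mem_range_ofFinEmbEquiv_symm_iff_mem s i).mpr his
    refine det_eq_zero_of_row_eq_zero j fun l => ?_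
    refine diagonal_apply_ne _ fun h => hit ?_
    rw [h]
    exact (Set.powersetCard.mem_range_ofFinEmbEquiv_symm_iff_mem t _).mp ⟨l, rfl⟩

lemma compoundMatrix_unitary {U : Matrix (Fin m) (Fin m) ℂ} (hU : Uᴴ * U = 1) :
    (compoundMatrix k U)ᴴ * compoundMatrix k U = 1 := by
  rw [← compoundMatrix_conjTranspose, ← compoundMatrix_mul, hU, compoundMatrix_one]

lemma compoundMatrix_conjDiag (U : Matrix (Fin m) (Fin m) ℂ) (d : Fin m → ℝ) :
    compoundMatrix k (conjDiag U d) = conjDiag (compoundMatrix k U)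
      fun s : Set.powersetCard (Fin m) k => ∏ i ∈ (s : Finset (Fin m)), d i := by
  rw [conjDiag, compoundMatrix_mul, compoundMatrix_mul, compoundMatrix_diagonal,
    compoundMatrix_conjTranspose]
  simp [conjDiag]

end Compound

/-! ### From log-majorization to sums. -/

section Majorization

/-- Abel summation: as the partial sums are nonnegative, their weight may be lowered from `a m` to
`a (m + 1)`. -/
lemma mul_sum_le_sum_mul_of_antitone {a x : ℕ → ℝ} (ha : Antitone a)
    (m : ℕ) (hx : ∀ k ≤ m + 1, 0 ≤ ∑ i ∈ Finset.range k, x i) :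
    a m * ∑ i ∈ Finset.range (m + 1), x i ≤ ∑ i ∈ Finset.range (m + 1), a i * x i := by
  induction m with
  | zero => simp
  | succ m ih =>
    have h1 := ih fun k hk => hx k (by omega)
    rw [Finset.sum_range_succ, Finset.sum_range_succ _ (m + 1), mul_add]
    have h2 := mul_le_mul_of_nonneg_right (ha (Nat.le_succ m)) (hx (m + 1) (by omega))
    exact add_le_add_left (h2.trans h1) _

/-- Weak log-majorization implies weak majorization of the total sums. -/
lemma sum_range_le_sum_range_of_prod_le {a b : ℕ → ℝ} (ha : Antitone a) (ha0 : ∀ i, 0 ≤ a i)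
    (hb0 : ∀ i, 0 ≤ b i) (m : ℕ)
    (h : ∀ k ≤ m, ∏ i ∈ Finset.range k, a i ≤ ∏ i ∈ Finset.range k, b i) :
    ∑ i ∈ Finset.range m, a i ≤ ∑ i ∈ Finset.range m, b i := by
  induction m with
  | zero => simp
  | succ m ih =>
    rcases (ha0 m).eq_or_lt with hm | hm
    · rw [Finset.sum_range_succ, Finset.sum_range_succ, ← hm]
      exact add_le_add (ih fun k hk => h k (by omega)) (hb0 m)
    · have hapos : ∀ i ∈ Finset.range (m + 1), 0 < a i := fun i hi =>
        hm.trans_le (ha (by simpa [Nat.lt_succ_iff] using hi))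
      have hbpos : ∀ i ∈ Finset.range (m + 1), 0 < b i := by
        intro i hi
        refine (hb0 i).lt_of_ne' fun h0 => ?_
        have := h (m + 1) le_rfl
        rw [Finset.prod_eq_zero hi h0] at this
        exact this.not_gt (Finset.prod_pos hapos)
      have hS : ∀ k ≤ m + 1, 0 ≤ ∑ i ∈ Finset.range k, (Real.log (b i) - Real.log (a i)) := by
        intro k hk
        have hsub : ∀ i ∈ Finset.range k, i ∈ Finset.range (m + 1) := fun i hi => by
          simp only [Finset.mem_range] at hi ⊢; omega
        rw [Finset.sum_sub_distrib, ← Real.log_prod fun i hi => (hbpos i (hsub i hi)).ne',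
          ← Real.log_prod fun i hi => (hapos i (hsub i hi)).ne', sub_nonneg]
        exact Real.log_le_log (Finset.prod_pos fun i hi => hapos i (hsub i hi)) (h k hk)
      have h1 := mul_sum_le_sum_mul_of_antitone ha m hS
      have h2 := mul_nonneg hm.le (hS (m + 1) le_rfl)
      -- Abel summation gives `0 ≤ ∑ a i * log (b i / a i)`, and `log t ≤ t - 1` bounds each term by
      -- `b i - a i`.
      rw [← sub_nonneg, ← Finset.sum_sub_distrib]
      refine (h2.trans h1).trans (Finset.sum_le_sum fun i hi => ?_)
      have hai := hapos i hi
      have hbi := hbpos i hi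
      rw [← Real.log_div hbi.ne' hai.ne']
      calc a i * Real.log (b i / a i) ≤ a i * (b i / a i - 1) :=
            mul_le_mul_of_nonneg_left (Real.log_le_sub_one_of_pos (by positivity)) hai.le
        _ = _ := by field_simp

lemma exists_perm_antitone {m : ℕ} (a : Fin m → ℝ) :
    ∃ e : Equiv.Perm (Fin m), Antitone (a ∘ e) := by
  refine ⟨Tuple.sort (fun i => -a i), fun i j hij => ?_⟩
  have := Tuple.monotone_sort (fun i => -a i) hij
  simpa using this

/-- The extension of a finite sequence by zero. -/
noncomputable def extendZero {m : ℕ} (a : Fin m → ℝ) (i : ℕ) : ℝ :=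
  if h : i < m then a ⟨i, h⟩ else 0

lemma extendZero_nonneg {m : ℕ} {a : Fin m → ℝ} (ha : 0 ≤ a) (i : ℕ) : 0 ≤ extendZero a i := by
  unfold extendZero
  split_ifs with h
  exacts [ha _, le_rfl]

lemma extendZero_antitone {m : ℕ} {a : Fin m → ℝ} (ha : 0 ≤ a) (h : Antitone a) :
    Antitone (extendZero a) := by
  intro i j hij
  by_cases hj : j < m
  · have hi : i < m := hij.trans_lt hj
    simpa [extendZero, hi, hj] using h (show (⟨i, hi⟩ : Fin m) ≤ ⟨j, hj⟩ from hij)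
  · simpa [extendZero, hj] using extendZero_nonneg ha i

lemma sum_range_extendZero {m : ℕ} (a : Fin m → ℝ) :
    ∑ i ∈ Finset.range m, extendZero a i = ∑ i, a i := by
  rw [Finset.sum_range]
  exact Finset.sum_congr rfl fun i _ => by simp [extendZero]

lemma le_apply_of_strictMono {k : ℕ} {f : Fin k → ℕ} (hf : StrictMono f) (i : Fin k) :
    (i : ℕ) ≤ f i := by
  obtain ⟨i, hi⟩ := i
  induction i with
  | zero => exact Nat.zero_le _
  | succ j ih =>
    have h1 := ih (by omega)
    have h2 := hf (show (⟨j, by omega⟩ : Fin k) < ⟨j + 1, hi⟩ from Nat.lt_succ_self j)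
    exact h1.trans_lt h2

/-- The `i`-th element of `t` in increasing order is at least `i`, and `b` decreases. -/
lemma prod_le_prod_range_extendZero {m : ℕ} {b : Fin m → ℝ} (hb0 : 0 ≤ b) (hb : Antitone b)
    (t : Finset (Fin m)) :
    ∏ i ∈ t, b i ≤ ∏ i ∈ Finset.range t.card, extendZero b i := by
  rw [Finset.prod_range, ← Finset.prod_coe_sort, ← (t.orderIsoOfFin rfl).toEquiv.prod_comp]
  refine Finset.prod_le_prod (fun i _ => hb0 _) fun i _ => ?_
  have hlt : (i : ℕ) < m := i.2.trans_le (by simpa using t.card_le_univ)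
  simp only [extendZero, hlt, dif_pos]
  refine hb ?_
  have hmono : StrictMono fun j : Fin t.card => ((t.orderIsoOfFin rfl j : Fin m) : ℕ) :=
    fun i j hij => (t.orderIsoOfFin rfl).strictMono hij
  exact le_apply_of_strictMono hmono i

/-- Taking for `s` the indices of the `k` largest `a i` suffices, since no `t` of size `k` beats the
`k` largest `b i`. -/
lemma sum_le_sum_of_prod_le {m : ℕ} {a b : Fin m → ℝ} (ha : 0 ≤ a) (hb : 0 ≤ b)
    (h : ∀ s : Finset (Fin m), ∃ t : Finset (Fin m), t.card = s.card ∧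
      ∏ i ∈ s, a i ≤ ∏ i ∈ t, b i) : ∑ i, a i ≤ ∑ i, b i := by
  obtain ⟨e, he⟩ := exists_perm_antitone a
  obtain ⟨f, hf⟩ := exists_perm_antitone b
  have ha' : 0 ≤ a ∘ e := fun i => ha (e i)
  have hb' : 0 ≤ b ∘ f := fun i => hb (f i)
  rw [← Equiv.sum_comp e a, ← Equiv.sum_comp f b]
  have key := sum_range_le_sum_range_of_prod_le (extendZero_antitone ha' he)
    (extendZero_nonneg ha') (extendZero_nonneg hb') m fun k hk => ?_
  · simpa only [sum_range_extendZero, Function.comp_apply] using key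
  · obtain ⟨t, ht, hle⟩ := h ((Finset.univ : Finset (Fin k)).map
      ((Fin.castLEEmb hk).trans e.toEmbedding))
    rw [Finset.prod_map] at hle
    simp only [Finset.card_map, Finset.card_univ, Fintype.card_fin] at ht
    have h1 := prod_le_prod_range_extendZero hb' hf (t.map f.symm.toEmbedding)
    rw [Finset.prod_map, Finset.card_map, ht] at h1
    refine le_trans (le_of_eq ?_) (hle.trans (le_trans (le_of_eq ?_) h1))
    · rw [Finset.prod_range]
      refine Finset.prod_congr rfl fun i _ => ?_
      have : (i : ℕ) < m := i.2.trans_le hk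
      simp [extendZero, this]
      rfl
    · simp

end Majorization

/-! ### The Araki-Lieb-Thirring inequality and two vanishing criteria. -/

section ArakiLiebThirring

open Matrix
open scoped Matrix.Norms.L2Operator MatrixOrder ComplexOrder

/-- Log-majorization of the spectrum of `(Y X Y) ^ p` by that of `Y ^ p X ^ p Y ^ p`. -/
lemma exists_prod_rpow_le {m : ℕ} {U V W W' : Matrix (Fin m) (Fin m) ℂ} (hU : Uᴴ * U = 1)
    (hV : Vᴴ * V = 1) (hW : Wᴴ * W = 1) (hW' : W'ᴴ * W' = 1) {x y a b : Fin m → ℝ}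
    (hx : 0 ≤ x) (hy : 0 ≤ y) (ha : 0 ≤ a) (hb : 0 ≤ b) {p : ℝ} (hp : 1 ≤ p)
    (h1 : conjDiag V y * conjDiag U x * conjDiag V y = conjDiag W a)
    (h2 : conjDiag V (fun i => y i ^ p) * conjDiag U (fun i => x i ^ p) *
      conjDiag V (fun i => y i ^ p) = conjDiag W' b) (s : Finset (Fin m)) :
    ∃ t : Finset (Fin m), t.card = s.card ∧ (∏ i ∈ s, a i) ^ p ≤ ∏ i ∈ t, b i := by
  let P := fun (d : Fin m → ℝ) (t : Set.powersetCard (Fin m) s.card) =>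
    ∏ i ∈ (t : Finset (Fin m)), d i
  have hP : ∀ d : Fin m → ℝ, 0 ≤ d → 0 ≤ P d := fun d hd t =>
    Finset.prod_nonneg fun i _ => hd i
  have hPp : ∀ d : Fin m → ℝ, 0 ≤ d → P (fun i => d i ^ p) = fun t => P d t ^ p :=
    fun d hd => funext fun t => Real.finsetProd_rpow _ _ (fun i _ => hd i) p
  have e1 := congrArg (compoundMatrix s.card) h1
  have e2 := congrArg (compoundMatrix s.card) h2
  simp only [compoundMatrix_mul, compoundMatrix_conjDiag] at e1 e2
  have key := norm_conj_rpow_le (compoundMatrix_unitary s.card hU)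
    (compoundMatrix_unitary s.card hV) (hP x hx) (hP y hy) hp
  rw [← hPp x hx, ← hPp y hy, e1, e2, norm_conjDiag (compoundMatrix_unitary s.card hW),
    norm_conjDiag (compoundMatrix_unitary s.card hW')] at key
  let s' : Set.powersetCard (Fin m) s.card := ⟨s, rfl⟩
  have : Nonempty (Set.powersetCard (Fin m) s.card) := ⟨s'⟩
  -- The norm of the compound of `conjDiag W' b` is its largest eigenvalue, attained at some `t`.
  obtain ⟨t, ht⟩ := Finite.exists_max (P b)
  refine ⟨t, t.2, ?_⟩
  have k1 : P a s' ≤ ‖P a‖ := (le_abs_self _).trans (norm_le_pi_norm (P a) s')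
  have k2 : ‖P b‖ ≤ P b t := (pi_norm_le_iff_of_nonneg (hP b hb t)).mpr fun t' => by
    rw [Real.norm_of_nonneg (hP b hb t')]
    exact ht t'
  exact (Real.rpow_le_rpow (hP a ha s') k1 (by linarith)).trans (key.trans k2)

/-- The Araki-Lieb-Thirring inequality `Tr (Y X Y) ^ (p z) ≤ Tr (Y ^ p X ^ p Y ^ p) ^ z`, in terms
of eigenvalues. -/
lemma sum_rpow_le_sum_rpow {m : ℕ} {U V W W' : Matrix (Fin m) (Fin m) ℂ} (hU : Uᴴ * U = 1)
    (hV : Vᴴ * V = 1) (hW : Wᴴ * W = 1) (hW' : W'ᴴ * W' = 1) {x y a b : Fin m → ℝ}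
    (hx : 0 ≤ x) (hy : 0 ≤ y) (ha : 0 ≤ a) (hb : 0 ≤ b) {p : ℝ} (hp : 1 ≤ p)
    (h1 : conjDiag V y * conjDiag U x * conjDiag V y = conjDiag W a)
    (h2 : conjDiag V (fun i => y i ^ p) * conjDiag U (fun i => x i ^ p) *
      conjDiag V (fun i => y i ^ p) = conjDiag W' b) {z : ℝ} (hz : 0 < z) :
    ∑ i, a i ^ (p * z) ≤ ∑ i, b i ^ z := by
  refine sum_le_sum_of_prod_le (fun i => Real.rpow_nonneg (ha i) _)
    (fun i => Real.rpow_nonneg (hb i) _) fun s => ?_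
  obtain ⟨t, ht, hle⟩ := exists_prod_rpow_le hU hV hW hW' hx hy ha hb hp h1 h2 s
  refine ⟨t, ht, ?_⟩
  have ha' : 0 ≤ ∏ i ∈ s, a i := Finset.prod_nonneg fun i _ => ha i
  rw [Real.finsetProd_rpow _ _ fun i _ => ha i, Real.finsetProd_rpow _ _ fun i _ => hb i,
    Real.rpow_mul ha']
  exact Real.rpow_le_rpow (Real.rpow_nonneg ha' _) hle hz.le

lemma conjDiag_mul_eq_zero {n : Type*} [Fintype n] [DecidableEq n] {U M : Matrix n n ℂ}
    (hU : Uᴴ * U = 1) {d e : n → ℝ} (hde : ∀ i, d i = 0 → e i = 0)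
    (h : conjDiag U d * M = 0) : conjDiag U e * M = 0 := by
  have h1 : diagonal (fun i => (d i : ℂ)) * (Uᴴ * M) = 0 := by
    calc _ = Uᴴ * U * diagonal (fun i => (d i : ℂ)) * (Uᴴ * M) := by rw [hU, Matrix.one_mul]
      _ = Uᴴ * (conjDiag U d * M) := by simp only [conjDiag, Matrix.mul_assoc]
      _ = 0 := by rw [h, Matrix.mul_zero]
  have h2 : diagonal (fun i => (e i : ℂ)) * (Uᴴ * M) = 0 := by
    ext i j
    have := congrFun₂ h1 i j
    simp only [diagonal_mul, Matrix.zero_apply, mul_eq_zero, Complex.ofReal_eq_zero] at this ⊢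
    exact this.imp (hde i) id
  rw [conjDiag, Matrix.mul_assoc, Matrix.mul_assoc, h2, Matrix.mul_zero]

/-- With `X = Bᴴ * B`, the hypothesis reads `(B * Y)ᴴ * (B * Y) = 0`, so `B * Y = 0`. -/
lemma mul_eq_zero_of_conj_eq_zero {n : Type*} [Fintype n] {X Y : Matrix n n ℂ}
    (hX : X.PosSemidef) (hY : Y.IsHermitian) (h : Y * X * Y = 0) : X * Y = 0 := by
  classical
  obtain ⟨B, rfl⟩ := CStarAlgebra.nonneg_iff_eq_star_mul_self.mp hX.nonneg
  have : (B * Y)ᴴ * (B * Y) = 0 := by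
    rw [conjTranspose_mul, hY.eq, ← h]
    simp only [star_eq_conjTranspose, Matrix.mul_assoc]
  rw [star_eq_conjTranspose, Matrix.mul_assoc, conjTranspose_mul_self_eq_zero.mp this, Matrix.mul_zero]

end ArakiLiebThirring

/-! ### Transfer to operators; monotonicity and positivity of the trace. -/

section Transfer

open Matrix
open scoped Matrix.Norms.L2Operator ComplexOrder

/-- The function `x ↦ x ^ s` on the nonzero reals, extended by `0`. -/
noncomputable def supportRpow (s x : ℝ) : ℝ := if x = 0 then 0 else x ^ s

lemma supportRpow_nonneg {x : ℝ} (hx : 0 ≤ x) (s : ℝ) : 0 ≤ supportRpow s x := by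
  unfold supportRpow
  split_ifs
  exacts [le_rfl, Real.rpow_nonneg hx s]

lemma supportRpow_eq_zero_iff {x : ℝ} (hx : 0 ≤ x) (s : ℝ) : supportRpow s x = 0 ↔ x = 0 := by
  unfold supportRpow
  split_ifs with h
  · simp [h]
  · simp only [h, iff_false]
    exact (Real.rpow_pos_of_pos (hx.lt_of_ne' h) s).ne'

lemma supportRpow_of_pos {s : ℝ} (hs : 0 < s) (x : ℝ) : supportRpow s x = x ^ s := by
  unfold supportRpow
  split_ifs with h
  · rw [h, Real.zero_rpow hs.ne']
  · rfl

lemma supportRpow_rpow {x : ℝ} (hx : 0 ≤ x) (s : ℝ) {p : ℝ} (hp : 0 < p) :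
    supportRpow s x ^ p = supportRpow (s * p) x := by
  unfold supportRpow
  split_ifs
  · exact Real.zero_rpow hp.ne'
  · exact (Real.rpow_mul hx s p).symm

variable {H : Type*} [NormedAddCommGroup H] [InnerProductSpace ℂ H] [FiniteDimensional ℂ H]
  [CompleteSpace H]

variable (H) in
/-- Operators as matrices with respect to the standard orthonormal basis. -/
noncomputable def operatorMatrix : (H →L[ℂ] H) ≃⋆ₐ[ℂ]
    Matrix (Fin (Module.finrank ℂ H)) (Fin (Module.finrank ℂ H)) ℂ :=
  (stdOrthonormalBasis ℂ H).repr.conjStarAlgEquiv.trans Matrix.toEuclideanCLM.symm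

lemma trace_operatorMatrix (T : H →L[ℂ] H) :
    (operatorMatrix H T).trace = LinearMap.trace ℂ H (T : H →ₗ[ℂ] H) := by
  rw [LinearMap.trace_eq_matrix_trace ℂ (stdOrthonormalBasis ℂ H).toBasis]
  rfl

lemma operatorMatrix_posSemidef {T : H →L[ℂ] H} (hT : T.IsPositive) :
    (operatorMatrix H T).PosSemidef := by
  obtain ⟨S, rfl⟩ := CStarAlgebra.nonneg_iff_eq_star_mul_self.mp
    ((ContinuousLinearMap.nonneg_iff_isPositive T).mpr hT)
  rw [map_mul, map_star]
  exact posSemidef_conjTranspose_mul_self _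

lemma operatorMatrix_supportPow {T : H →L[ℂ] H}
    {U : Matrix (Fin (Module.finrank ℂ H)) (Fin (Module.finrank ℂ H)) ℂ} (hU : Uᴴ * U = 1)
    {d : Fin (Module.finrank ℂ H) → ℝ} (h : operatorMatrix H T = conjDiag U d) (s : ℝ) :
    operatorMatrix H (supportPow T s) = conjDiag U (supportRpow s ∘ d) := by
  have hT : T = (operatorMatrix H).symm (conjDiag U d) := by rw [← h]; simp
  have hsa : IsSelfAdjoint (conjDiag U d) := conjDiag_isHermitian U d
  have hc : Continuous (operatorMatrix H).symm :=
    LinearMap.continuous_of_finiteDimensional (operatorMatrix H).symm.toAlgEquiv.toLinearMap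
  -- `supportRpow s` may jump at `0`, but every function is continuous on a finite spectrum.
  have := StarAlgHomClass.map_cfc (S := ℂ) (operatorMatrix H).symm (supportRpow s)
    (conjDiag U d) ((conjDiag U d).finite_real_spectrum.continuousOn _) hc hsa (hsa.map _)
  rw [← cfc_conjDiag hU, supportPow, hT]
  refine (congrArg (operatorMatrix H) this.symm).trans ?_
  simp

/-- The trace functional inside the logarithm of `alphaZDivergence`. -/
noncomputable def alphaZTrace (α z : ℝ) (ρ σ : H →L[ℂ] H) : ℝ :=
  (LinearMap.trace ℂ H
    ((supportPow (supportPow σ ((1 - α) / (2 * z)) * supportPow ρ (α / z) *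
      supportPow σ ((1 - α) / (2 * z))) z : H →L[ℂ] H) : H →ₗ[ℂ] H)).re

lemma exists_alphaZTrace_eq {ρ σ : H →L[ℂ] H}
    {U V : Matrix (Fin (Module.finrank ℂ H)) (Fin (Module.finrank ℂ H)) ℂ} (hU : Uᴴ * U = 1)
    (hV : Vᴴ * V = 1) {r s : Fin (Module.finrank ℂ H) → ℝ} (hr : 0 ≤ r)
    (hρ : operatorMatrix H ρ = conjDiag U r) (hσ : operatorMatrix H σ = conjDiag V s)
    (α : ℝ) {z : ℝ} (hz : 0 < z) :
    ∃ (W : Matrix (Fin (Module.finrank ℂ H)) (Fin (Module.finrank ℂ H)) ℂ)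
      (a : Fin (Module.finrank ℂ H) → ℝ), Wᴴ * W = 1 ∧ 0 ≤ a ∧
      conjDiag V (supportRpow ((1 - α) / (2 * z)) ∘ s) * conjDiag U (supportRpow (α / z) ∘ r) *
        conjDiag V (supportRpow ((1 - α) / (2 * z)) ∘ s) = conjDiag W a ∧
      alphaZTrace α z ρ σ = ∑ i, a i ^ z := by
  have hpsd : (conjDiag V (supportRpow ((1 - α) / (2 * z)) ∘ s) *
      conjDiag U (supportRpow (α / z) ∘ r) *
      conjDiag V (supportRpow ((1 - α) / (2 * z)) ∘ s)).PosSemidef := by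
    have := (conjDiag_posSemidef U (d := supportRpow (α / z) ∘ r)
      fun i => supportRpow_nonneg (hr i) _).mul_mul_conjTranspose_same
      (conjDiag V (supportRpow ((1 - α) / (2 * z)) ∘ s))
    rwa [(conjDiag_isHermitian V _).eq] at this
  obtain ⟨W, a, hW, ha, h⟩ := hpsd.exists_conjDiag
  refine ⟨W, a, hW, ha, h, ?_⟩
  have h' : operatorMatrix H (supportPow σ ((1 - α) / (2 * z)) * supportPow ρ (α / z) *
      supportPow σ ((1 - α) / (2 * z))) = conjDiag W a := by
    rw [map_mul, map_mul, operatorMatrix_supportPow hU hρ, operatorMatrix_supportPow hV hσ, h]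
  rw [alphaZTrace, ← trace_operatorMatrix, operatorMatrix_supportPow hW h', trace_conjDiag hW,
    Complex.ofReal_re]
  exact Finset.sum_congr rfl fun i _ => supportRpow_of_pos hz _

lemma alphaZTrace_antitone {ρ σ : H →L[ℂ] H} (hρ : ρ.IsPositive) (hσ : σ.IsPositive) (α : ℝ)
    {z w : ℝ} (hz : 0 < z) (hzw : z ≤ w) : alphaZTrace α w ρ σ ≤ alphaZTrace α z ρ σ := by
  have hw := hz.trans_le hzw
  obtain ⟨U, r, hU, hr, eρ⟩ := (operatorMatrix_posSemidef hρ).exists_conjDiag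
  obtain ⟨V, s, hV, hs, eσ⟩ := (operatorMatrix_posSemidef hσ).exists_conjDiag
  obtain ⟨W, a, hW, ha, h1, ea⟩ := exists_alphaZTrace_eq hU hV hr eρ eσ α hw
  obtain ⟨W', b, hW', hb, h2, eb⟩ := exists_alphaZTrace_eq hU hV hr eρ eσ α hz
  have hp : 0 < w / z := by positivity
  -- Since `w / z > 0`, raising to this power keeps the value `0` at `0`, so it only rescales the
  -- exponent.
  have c1 : (fun i => (supportRpow ((1 - α) / (2 * w)) ∘ s) i ^ (w / z)) =
      supportRpow ((1 - α) / (2 * z)) ∘ s := by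
    funext i
    rw [Function.comp_apply, supportRpow_rpow (hs i) _ hp]
    congr 1
    field_simp
  have c2 : (fun i => (supportRpow (α / w) ∘ r) i ^ (w / z)) = supportRpow (α / z) ∘ r := by
    funext i
    rw [Function.comp_apply, supportRpow_rpow (hr i) _ hp]
    congr 1
    field_simp
  rw [← c1, ← c2] at h2
  have key := sum_rpow_le_sum_rpow hU hV hW hW' (fun i => supportRpow_nonneg (hr i) _)
    (fun i => supportRpow_nonneg (hs i) _) ha hb ((one_le_div hz).mpr hzw) h1 h2 hz
  rwa [div_mul_cancel₀ _ hz.ne', ← ea, ← eb] at key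

lemma alphaZTrace_pos {ρ σ : H →L[ℂ] H} (hρ : IsDensityOperator ρ) (hσ : σ.IsPositive)
    (hρσ : Dominates σ ρ) (α : ℝ) {z : ℝ} (hz : 0 < z) : 0 < alphaZTrace α z ρ σ := by
  obtain ⟨U, r, hU, hr, eρ⟩ := (operatorMatrix_posSemidef hρ.1).exists_conjDiag
  obtain ⟨V, s, hV, hs, eσ⟩ := (operatorMatrix_posSemidef hσ).exists_conjDiag
  obtain ⟨W, a, hW, ha, h1, ea⟩ := exists_alphaZTrace_eq hU hV hr eρ eσ α hz
  rw [ea]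
  refine (Finset.sum_nonneg fun i _ => Real.rpow_nonneg (ha i) _).lt_of_ne' fun h0 => ?_
  have ha0 : a = 0 := by
    funext i
    have := (Finset.sum_eq_zero_iff_of_nonneg fun i _ => Real.rpow_nonneg (ha i) _).mp h0 i
      (Finset.mem_univ i)
    exact ((Real.rpow_eq_zero_iff_of_nonneg (ha i)).mp this).1
  have hWa : conjDiag W a = 0 := by simp [conjDiag, ha0]
  rw [hWa] at h1
  have h2 := mul_eq_zero_of_conj_eq_zero
    (conjDiag_posSemidef U fun i => supportRpow_nonneg (hr i) _) (conjDiag_isHermitian V _) h1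
  have h3 := conjDiag_mul_eq_zero hU
    (fun i hi => (supportRpow_eq_zero_iff (hr i) _).mp hi) h2
  have h4 := congrArg conjTranspose h3
  rw [conjTranspose_mul, (conjDiag_isHermitian V _).eq, (conjDiag_isHermitian U _).eq,
    conjTranspose_zero] at h4
  have h5 := conjDiag_mul_eq_zero hV
    (fun i hi => (supportRpow_eq_zero_iff (hs i) _).mp hi) h4
  have h6 : σ * ρ = 0 := by
    have h : operatorMatrix H (σ * ρ) = 0 := by rw [map_mul, eρ, eσ, h5]
    simpa using congrArg (operatorMatrix H).symm h
  -- The range of `ρ` lies in `ker σ ⊆ ker ρ`, so `ρ * ρ = 0`.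
  have h7 : star ρ * ρ = 0 := by
    rw [hρ.1.isSelfAdjoint.star_eq]
    ext v
    exact hρσ (congrArg (fun T : H →L[ℂ] H => T v) h6)
  have h8 : ρ = 0 := (CStarRing.star_mul_self_eq_zero_iff ρ).mp h7
  have := hρ.2
  rw [h8] at this
  simp at this

end Transfer

theorem proposition13 {H : Type*} [NormedAddCommGroup H] [InnerProductSpace ℂ H]
    [FiniteDimensional ℂ H] [CompleteSpace H] (ρ σ : H →L[ℂ] H)
    (hρ : IsDensityOperator ρ) (hσ : σ.IsPositive) (hρσ : Dominates σ ρ)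
    (α : ℝ) (hα : α ≠ 1) :
    (1 < α → AntitoneOn (fun z : ℝ => alphaZDivergence α z ρ σ) (Set.Ioi 0)) ∧
      (α < 1 → MonotoneOn (fun z : ℝ => alphaZDivergence α z ρ σ) (Set.Ioi 0)) := by
  have key : ∀ z ∈ Set.Ioi (0 : ℝ), ∀ w ∈ Set.Ioi (0 : ℝ), z ≤ w →
      Real.log (alphaZTrace α w ρ σ) ≤ Real.log (alphaZTrace α z ρ σ) :=
    fun z hz w hw hzw => Real.log_le_log (alphaZTrace_pos hρ hσ hρσ α hw)
      (alphaZTrace_antitone hρ.1 hσ α hz hzw)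
  refine ⟨fun h z hz w hw hzw => ?_, fun h z hz w hw hzw => ?_⟩
  · exact mul_le_mul_of_nonneg_left (key z hz w hw hzw)
      (one_div_nonneg.mpr (sub_nonneg.mpr h.le))
  · exact mul_le_mul_of_nonpos_left (key z hz w hw hzw)
      (one_div_nonpos.mpr (sub_nonpos.mpr h.le))
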